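/- Let $d\in\mathbb{N}$ and let $\Lambda=\prod_{j=1}^d (l_j,r_j)\subset\mathbb{R}^d$ be a generalized rectangle, where $l_j,r_j\in\mathbb{R}\cup\{\pm\infty\}$ and $l_j<r_j$ for every $j$. A measurable function $W\colon\Lambda\to\mathbb{R}$ is called admissible (on $\Lambda$) if the domain $\mathcal{D}(W)=\{\psi\in L^2(\Lambda) : W\psi\in L^2(\Lambda)\}$ of the multiplication operator by $W$ in the complex Hilbert space $L^2(\Lambda)$ contains the Sobolev space $H^1(\Lambda)$. Let $V\colon\Lambda\to\mathbb{R}$ be measurable and assume that $V^2$ is admissible. Then $V$ is admissible, and there are $a,b\ge 0$ (depending only on $\Lambda$ and $V$) such that for every $\varepsilon>0$ the inequality \[ \|V\psi\|_{L^2(\Lambda)}^2\le \lambda_1\|\nabla\psi\|_{L^2(\Lambda)}^2+\lambda_2\|\psi\|_{L^2(\Lambda)}^2,\qquad \psi\in H^1(\Lambda), \] holds with $\lambda_1=a\varepsilon$ and $\lambda_2=a/\varepsilon+b$. -/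

import Mathlib

open MeasureTheory TopologicalSpace Set
open scoped Distributions ENNReal ContDiff

noncomputable section

namespace AdmissiblePotential

/-- The generalized rectangle `∏ⱼ (aⱼ, bⱼ)` in `ℝᵈ`, with endpoints `aⱼ, bⱼ ∈ ℝ ∪ {±∞}`. -/
def genRect {d : ℕ} (a b : Fin d → EReal) : Opens (EuclideanSpace ℝ (Fin d)) where
  carrier := {x | ∀ j, a j < (x j : EReal) ∧ (x j : EReal) < b j}
  is_open' := by
    simp only [ofPred_forall]
    refine isOpen_iInter_of_finite fun j => ?_
    have hc : Continuous fun x : EuclideanSpace ℝ (Fin d) => (x j : EReal) :=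
      continuous_coe_real_ereal.comp (by fun_prop)
    exact (isOpen_lt continuous_const hc).inter (isOpen_lt hc continuous_const)

/-- Lebesgue measure on an open subset of `ℝᵈ`. -/
instance instMeasureSpaceOpens {d : ℕ} (Λ : Opens (EuclideanSpace ℝ (Fin d))) : MeasureSpace Λ where
  volume := Measure.comap Subtype.val volume

/-- The complex Hilbert space `L²(Λ)` with respect to Lebesgue measure on `Λ`. -/
abbrev L2 {d : ℕ} (Λ : Opens (EuclideanSpace ℝ (Fin d))) : Type :=
  Lp ℂ 2 (volume : Measure Λ)

/-- The Hilbert space `L²(Λ; ℂᵈ)` of square integrable vector fields, with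
`‖g‖² = ∫_Λ ∑ⱼ |gⱼ|²`. -/
abbrev L2Vec {d : ℕ} (Λ : Opens (EuclideanSpace ℝ (Fin d))) : Type :=
  Lp (EuclideanSpace ℂ (Fin d)) 2 (volume : Measure Λ)

/-- `HasWeakGradient ψ g`: the vector field `g ∈ L²(Λ; ℂᵈ)` is the weak gradient `∇ψ` of
`ψ ∈ L²(Λ)`, i.e. `∫_Λ ψ ∂ⱼφ = - ∫_Λ gⱼ φ` for every `j` and every test function
`φ ∈ C_c^∞(Λ)`. -/
def HasWeakGradient {d : ℕ} {Λ : Opens (EuclideanSpace ℝ (Fin d))} (ψ : L2 Λ) (g : L2Vec Λ) :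
    Prop :=
  ∀ (φ : 𝓓(Λ, ℝ)) (j : Fin d),
    ∫ x : Λ, fderiv ℝ φ x (EuclideanSpace.single j 1) • ψ x = - ∫ x : Λ, φ x • (g x) j

theorem integrable_smul_of_hasCompactSupport {d : ℕ} {Λ : Opens (EuclideanSpace ℝ (Fin d))}
    {f : EuclideanSpace ℝ (Fin d) → ℝ} (hf : Continuous f) (hs : HasCompactSupport f)
    {u : Λ → ℂ} (hu : MemLp u 2 volume) : Integrable (fun x : Λ => f x • u x) volume := by
  have h1 : MemLp f 2 ((volume : Measure (EuclideanSpace ℝ (Fin d))).restrict Λ) :=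
    (hf.memLp_of_hasCompactSupport hs).restrict _
  have h2 : MemLp (fun x : Λ => f x) 2 volume :=
    h1.comp_measurePreserving (measurePreserving_subtype_coe Λ.isOpen.measurableSet)
  exact memLp_one_iff_integrable.1 (hu.smul h2)

theorem integrable_test_smul {d : ℕ} {Λ : Opens (EuclideanSpace ℝ (Fin d))} (φ : 𝓓(Λ, ℝ))
    (j : Fin d) (g : L2Vec Λ) : Integrable (fun x : Λ => φ x • (g x) j) volume :=
  integrable_smul_of_hasCompactSupport φ.continuous φ.hasCompactSupport
    ((EuclideanSpace.proj j : EuclideanSpace ℂ (Fin d) →L[ℂ] ℂ).comp_memLp' (Lp.memLp g))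

theorem integrable_fderiv_test_smul {d : ℕ} {Λ : Opens (EuclideanSpace ℝ (Fin d))}
    (φ : 𝓓(Λ, ℝ)) (j : Fin d) (ψ : L2 Λ) :
    Integrable (fun x : Λ => fderiv ℝ φ x (EuclideanSpace.single j 1) • ψ x) volume :=
  integrable_smul_of_hasCompactSupport
    (f := fun x => fderiv ℝ φ x (EuclideanSpace.single j 1))
    ((φ.contDiff.continuous_fderiv (by simp)).clm_apply continuous_const)
    (φ.hasCompactSupport.fderiv_apply ℝ _) (Lp.memLp ψ)

theorem HasWeakGradient.add {d : ℕ} {Λ : Opens (EuclideanSpace ℝ (Fin d))} {ψ₁ ψ₂ : L2 Λ}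
    {g₁ g₂ : L2Vec Λ} (h₁ : HasWeakGradient ψ₁ g₁) (h₂ : HasWeakGradient ψ₂ g₂) :
    HasWeakGradient (ψ₁ + ψ₂) (g₁ + g₂) := by
  intro φ j
  have e₁ : ∫ x : Λ, fderiv ℝ φ x (EuclideanSpace.single j 1) • (ψ₁ + ψ₂ : L2 Λ) x
      = ∫ x : Λ, (fderiv ℝ φ x (EuclideanSpace.single j 1) • ψ₁ x
        + fderiv ℝ φ x (EuclideanSpace.single j 1) • ψ₂ x) := by
    refine integral_congr_ae ?_
    filter_upwards [Lp.coeFn_add ψ₁ ψ₂] with x hx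
    rw [hx, Pi.add_apply, smul_add]
  have e₂ : ∫ x : Λ, φ x • ((g₁ + g₂ : L2Vec Λ) x) j
      = ∫ x : Λ, (φ x • (g₁ x) j + φ x • (g₂ x) j) := by
    refine integral_congr_ae ?_
    filter_upwards [Lp.coeFn_add g₁ g₂] with x hx
    rw [hx, Pi.add_apply, PiLp.add_apply, smul_add]
  rw [e₁, e₂, integral_add (integrable_fderiv_test_smul φ j ψ₁)
    (integrable_fderiv_test_smul φ j ψ₂), integral_add (integrable_test_smul φ j g₁)
    (integrable_test_smul φ j g₂), h₁ φ j, h₂ φ j]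
  ring

theorem HasWeakGradient.smul {d : ℕ} {Λ : Opens (EuclideanSpace ℝ (Fin d))} {ψ : L2 Λ}
    {g : L2Vec Λ} (c : ℂ) (h : HasWeakGradient ψ g) : HasWeakGradient (c • ψ) (c • g) := by
  intro φ j
  have e₁ : ∫ x : Λ, fderiv ℝ φ x (EuclideanSpace.single j 1) • (c • ψ : L2 Λ) x
      = ∫ x : Λ, c • (fderiv ℝ φ x (EuclideanSpace.single j 1) • ψ x) := by
    refine integral_congr_ae ?_
    filter_upwards [Lp.coeFn_smul c ψ] with x hx
    rw [hx, Pi.smul_apply, smul_comm]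
  have e₂ : ∫ x : Λ, φ x • ((c • g : L2Vec Λ) x) j = ∫ x : Λ, c • (φ x • (g x) j) := by
    refine integral_congr_ae ?_
    filter_upwards [Lp.coeFn_smul c g] with x hx
    rw [hx, Pi.smul_apply, PiLp.smul_apply, smul_comm]
  rw [e₁, e₂, integral_smul, integral_smul, h φ j, smul_neg]

theorem hasWeakGradient_zero {d : ℕ} {Λ : Opens (EuclideanSpace ℝ (Fin d))} :
    HasWeakGradient (0 : L2 Λ) 0 := by
  intro φ j
  have e₁ : ∫ x : Λ, fderiv ℝ φ x (EuclideanSpace.single j 1) • (0 : L2 Λ) x = 0 := by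
    refine integral_eq_zero_of_ae ?_
    filter_upwards [Lp.coeFn_zero ℂ 2 (volume : Measure Λ)] with x hx
    simp only [hx, Pi.zero_apply, smul_zero]
  have e₂ : ∫ x : Λ, φ x • ((0 : L2Vec Λ) x) j = 0 := by
    refine integral_eq_zero_of_ae ?_
    filter_upwards [Lp.coeFn_zero (EuclideanSpace ℂ (Fin d)) 2 (volume : Measure Λ)] with x hx
    simp only [hx, Pi.zero_apply, PiLp.zero_apply, smul_zero]
  rw [e₁, e₂, neg_zero]

/-- The Sobolev space `H¹(Λ)`: all `ψ ∈ L²(Λ)` with a weak gradient in `L²(Λ; ℂᵈ)`. -/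
def H1 {d : ℕ} (Λ : Opens (EuclideanSpace ℝ (Fin d))) : Submodule ℂ (L2 Λ) where
  carrier := {ψ | ∃ g : L2Vec Λ, HasWeakGradient ψ g}
  add_mem' := fun ⟨g₁, h₁⟩ ⟨g₂, h₂⟩ => ⟨g₁ + g₂, h₁.add h₂⟩
  zero_mem' := ⟨0, hasWeakGradient_zero⟩
  smul_mem' := fun c _ ⟨g, h⟩ => ⟨c • g, h.smul c⟩

/-- The domain `𝒟(V) = {ψ ∈ L²(Λ) | Vψ ∈ L²(Λ)}` of the multiplication operator by `V`. -/
def mulDomain {d : ℕ} {Λ : Opens (EuclideanSpace ℝ (Fin d))} (V : Λ → ℝ) :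
    Submodule ℂ (L2 Λ) where
  carrier := {ψ | MemLp (fun x => (V x : ℂ) * ψ x) 2 volume}
  add_mem' := fun {ψ₁ ψ₂} h₁ h₂ => (MemLp.add h₁ h₂).ae_eq (by
    filter_upwards [Lp.coeFn_add ψ₁ ψ₂] with x hx
    rw [hx, Pi.add_apply, Pi.add_apply, mul_add])
  zero_mem' := (MemLp.zero' (ε := ℂ)).ae_eq (by
    filter_upwards [Lp.coeFn_zero ℂ 2 (volume : Measure Λ)] with x hx
    rw [hx, Pi.zero_apply, mul_zero])
  smul_mem' := fun c ψ h => (MemLp.const_smul h c).ae_eq (by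
    filter_upwards [Lp.coeFn_smul c ψ] with x hx
    rw [hx, Pi.smul_apply, Pi.smul_apply, mul_smul_comm])

theorem memLp_of_mem_mulDomain {d : ℕ} {Λ : Opens (EuclideanSpace ℝ (Fin d))} {V : Λ → ℝ}
    {ψ : L2 Λ} (h : ψ ∈ mulDomain V) : MemLp (fun x => (V x : ℂ) * ψ x) 2 volume := h

/-- The maximal multiplication operator `ψ ↦ Vψ` in `L²(Λ)`. -/
def mulOp {d : ℕ} {Λ : Opens (EuclideanSpace ℝ (Fin d))} (V : Λ → ℝ) : L2 Λ →ₗ.[ℂ] L2 Λ where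
  domain := mulDomain V
  toFun :=
    { toFun := fun ψ => MemLp.toLp (fun x => (V x : ℂ) * (ψ : L2 Λ) x) (memLp_of_mem_mulDomain ψ.2)
      map_add' := fun ψ₁ ψ₂ => by
        rw [← MemLp.toLp_add]
        refine MemLp.toLp_congr _ _ ?_
        filter_upwards [Lp.coeFn_add (ψ₁ : L2 Λ) ψ₂] with x hx
        rw [Submodule.coe_add, hx, Pi.add_apply, Pi.add_apply, mul_add]
      map_smul' := fun c ψ => by
        rw [RingHom.id_apply, ← MemLp.toLp_const_smul]
        refine MemLp.toLp_congr _ _ ?_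
        filter_upwards [Lp.coeFn_smul c (ψ : L2 Λ)] with x hx
        rw [Submodule.coe_smul, hx, Pi.smul_apply, Pi.smul_apply, mul_smul_comm] }

/-- `V : Λ → ℝ` is admissible on `Λ` if it is measurable and `𝒟(V) ⊇ H¹(Λ)`. -/
def Admissible {d : ℕ} {Λ : Opens (EuclideanSpace ℝ (Fin d))} (V : Λ → ℝ) : Prop :=
  Measurable V ∧ H1 Λ ≤ (mulOp V).domain

/-- The constants `lam₁, lam₂ ≥ 0` are as in the form bound of an admissible potential `V`:
`‖Vψ‖² ≤ lam₁ ‖∇ψ‖² + lam₂ ‖ψ‖²` for all `ψ ∈ H¹(Λ)`. -/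
def IsFormBound {d : ℕ} {Λ : Opens (EuclideanSpace ℝ (Fin d))} {V : Λ → ℝ} (hV : Admissible V)
    (lam₁ lam₂ : ℝ) : Prop :=
  0 ≤ lam₁ ∧ 0 ≤ lam₂ ∧ ∀ (ψ : H1 Λ) (g : L2Vec Λ), HasWeakGradient (ψ : L2 Λ) g →
    ‖mulOp V ⟨ψ, hV.2 ψ.2⟩‖ ^ 2 ≤ lam₁ * ‖g‖ ^ 2 + lam₂ * ‖(ψ : L2 Λ)‖ ^ 2

end AdmissiblePotential

end

/-!
Multiplication by `W` is a closed operator, and `H¹(Λ)`, realised as the closed graph of the weak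
gradient, is a Banach space. If `W` is admissible, the closed graph theorem therefore makes
`W : H¹(Λ) → L²(Λ)` bounded, say `‖Wψ‖ ≤ C (‖∇ψ‖ + ‖ψ‖)`. Take `W = V²`: Hölder's inequality for
`|Vψ|² = |V²ψ| |ψ|` gives `‖Vψ‖² ≤ ‖V²ψ‖ ‖ψ‖ ≤ C (‖∇ψ‖ + ‖ψ‖) ‖ψ‖`, and Young's inequality with
weight `ε` splits the product `‖∇ψ‖ ‖ψ‖`, so that `a = C / 2` and `b = C` work.
-/

namespace AdmissiblePotential

open Filter Topology

section Lp

variable {α E F G : Type*} [MeasurableSpace α] {μ : Measure α}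
  [NormedAddCommGroup E] [NormedAddCommGroup F] [NormedAddCommGroup G] {p q : ℝ≥0∞}

theorem eLpNorm_smul_sq_le_mul {𝕜 : Type*} [NormedField 𝕜] [NormedSpace 𝕜 E] {V : α → 𝕜} {f : α → E}
    (hVf : AEStronglyMeasurable (fun x => V x ^ 2 • f x) μ) (hf : AEStronglyMeasurable f μ) :
    eLpNorm (fun x => V x • f x) p μ ^ 2 ≤
      eLpNorm (fun x => V x ^ 2 • f x) p μ * eLpNorm f p μ := by
  have : ENNReal.HolderTriple p p (p / 2) :=
    ⟨by rw [ENNReal.inv_div (by simp) (by simp), ENNReal.div_eq_inv_mul, mul_two]⟩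
  have norm_sq (x : α) : ‖V x • f x‖ ^ (2 : ℝ) = ‖V x ^ 2 • f x‖ * ‖f x‖ := by
    simp only [Real.rpow_two, norm_smul, norm_pow]
    ring
  calc eLpNorm (fun x => V x • f x) p μ ^ 2
      = eLpNorm (fun x => ‖V x ^ 2 • f x‖ * ‖f x‖) (p / 2) μ := by
        rw [← funext norm_sq, eLpNorm_norm_rpow _ two_pos, ENNReal.ofReal_ofNat,
          ENNReal.div_mul_cancel two_ne_zero ENNReal.ofNat_ne_top, ENNReal.rpow_two]
    _ ≤ eLpNorm (fun x => ‖V x ^ 2 • f x‖) p μ * eLpNorm (fun x => ‖f x‖) p μ :=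
        eLpNorm_smul_le_mul_eLpNorm (φ := fun x => ‖V x ^ 2 • f x‖) hf.norm hVf.norm
    _ = eLpNorm (fun x => V x ^ 2 • f x) p μ * eLpNorm f p μ := by
        rw [eLpNorm_norm, eLpNorm_norm]

theorem memLp_smul_of_memLp_sq_smul {𝕜 : Type*} [NormedField 𝕜] [NormedSpace 𝕜 E] {V : α → 𝕜}
    {f : α → E} (hVf : AEStronglyMeasurable (fun x => V x • f x) μ)
    (hV2f : MemLp (fun x => V x ^ 2 • f x) p μ) (hf : MemLp f p μ) :
    MemLp (fun x => V x • f x) p μ := by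
  refine ⟨hVf, (ENNReal.pow_lt_top_iff.1 ?_).resolve_right two_ne_zero⟩
  exact (eLpNorm_smul_sq_le_mul hV2f.1 hf.1).trans_lt (ENNReal.mul_lt_top hV2f.2 hf.2)

theorem isClosed_setOf_ae_mem [Fact (1 ≤ p)] [Fact (1 ≤ q)] {S : α → Set (E × F)}
    (hS : ∀ x, IsClosed (S x)) :
    IsClosed {u : Lp E p μ × Lp F q μ | ∀ᵐ x ∂μ, (u.1 x, u.2 x) ∈ S x} := by
  refine isSeqClosed_iff_isClosed.1 fun u v hu huv => ?_
  obtain ⟨s, hs, hs_ae⟩ :=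
    (tendstoInMeasure_of_tendsto_Lp huv.fst_nhds).exists_seq_tendsto_ae
  obtain ⟨t, ht, ht_ae⟩ :=
    (tendstoInMeasure_of_tendsto_Lp
      (huv.snd_nhds.comp hs.tendsto_atTop)).exists_seq_tendsto_ae
  filter_upwards [hs_ae, ht_ae, ae_all_iff.2 hu] with x hx₁ hx₂ hx_mem
  exact (hS x).mem_of_tendsto ((hx₁.comp ht.tendsto_atTop).prodMk_nhds hx₂)
    (Eventually.of_forall fun n => hx_mem (s (t n)))

theorem continuous_integral_bilin {𝕜 : Type*} [RCLike 𝕜] [NormedSpace 𝕜 E] [NormedSpace 𝕜 F]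
    [NormedSpace 𝕜 G] [NormedSpace ℝ G] [SMulCommClass ℝ 𝕜 G] [CompleteSpace G] [Fact (1 ≤ p)]
    [Fact (1 ≤ q)] [p.HolderConjugate q] (B : E →L[𝕜] F →L[𝕜] G) {f : α → E} (hf : MemLp f p μ) :
    Continuous fun u : Lp F q μ => ∫ x, B (f x) (u x) ∂μ := by
  refine (B.lpPairing μ p q (hf.toLp f)).continuous.congr fun u => ?_
  rw [ContinuousLinearMap.lpPairing_eq_integral]
  refine integral_congr_ae ?_
  filter_upwards [hf.coeFn_toLp] with x hx
  rw [hx]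

end Lp

theorem exists_norm_comp_le_of_isClosed {𝕜 E F X : Type*} [NontriviallyNormedField 𝕜]
    [AddCommGroup E] [Module 𝕜 E] [TopologicalSpace E]
    [NormedAddCommGroup F] [NormedSpace 𝕜 F] [CompleteSpace F]
    [NormedAddCommGroup X] [NormedSpace 𝕜 X] [CompleteSpace X]
    {T : E →ₗ.[𝕜] F} (hT : T.IsClosed) (ι : X →L[𝕜] E) (hι : ∀ x, ι x ∈ T.domain) :
    ∃ C : ℝ, 0 ≤ C ∧ ∀ x, ‖T ⟨ι x, hι x⟩‖ ≤ C * ‖x‖ := by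
  let S : X →ₗ[𝕜] F := T.toFun.comp ((ι : X →ₗ[𝕜] E).codRestrict T.domain hι)
  have graph_eq : (S.graph : Set (X × F)) = Prod.map ι id ⁻¹' (T.graph : Set (E × F)) := by
    ext ⟨x, y⟩
    exact T.image_iff (hι x)
  have hS : IsClosed (S.graph : Set (X × F)) :=
    graph_eq ▸ hT.preimage (ι.continuous.prodMap continuous_id)
  let S' : X →L[𝕜] F := .ofIsClosedGraph hS
  exact ⟨‖S'‖, norm_nonneg S', S'.le_opNorm⟩

variable {d : ℕ} {Λ : Opens (EuclideanSpace ℝ (Fin d))}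

theorem continuous_integral_smul_clm {E F : Type*} [NormedAddCommGroup E] [NormedSpace ℝ E]
    [NormedAddCommGroup F] [NormedSpace ℝ F] [CompleteSpace F]
    {f : EuclideanSpace ℝ (Fin d) → ℝ} (hf : Continuous f) (hs : HasCompactSupport f)
    (L : E →L[ℝ] F) :
    Continuous fun u : Lp E 2 (volume : Measure Λ) => ∫ x : Λ, f x • L (u x) := by
  have hfΛ : MemLp (fun x : Λ => f x) 2 volume :=
    ((hf.memLp_of_hasCompactSupport hs).restrict _).comp_measurePreserving
      (measurePreserving_subtype_coe Λ.isOpen.measurableSet)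
  exact continuous_integral_bilin ((ContinuousLinearMap.lsmul ℝ ℝ).bilinearComp (.id ℝ ℝ) L) hfΛ

/-- The graph of the weak gradient, viewed as an unbounded operator from `L²(Λ)` to `L²(Λ; ℂᵈ)`.
With the norm of the product it stands in for the Banach space `H¹(Λ)`, since `ψ ↦ (ψ, ∇ψ)`
carries the `H¹` norm to an equivalent one. -/
def weakGradientGraph (Λ : Opens (EuclideanSpace ℝ (Fin d))) : Submodule ℂ (L2 Λ × L2Vec Λ) where
  carrier := {u | HasWeakGradient u.1 u.2}
  add_mem' := HasWeakGradient.add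
  zero_mem' := hasWeakGradient_zero
  smul_mem' c _ h := h.smul c

theorem isClosed_weakGradientGraph :
    IsClosed (weakGradientGraph Λ : Set (L2 Λ × L2Vec Λ)) := by
  change IsClosed {u : L2 Λ × L2Vec Λ | HasWeakGradient u.1 u.2}
  simp only [HasWeakGradient, Set.ofPred_forall]
  refine isClosed_iInter fun φ => isClosed_iInter fun j => isClosed_eq ?_ ?_
  · have hφ' : Continuous fun x => fderiv ℝ φ x (EuclideanSpace.single j 1) :=
      (φ.contDiff.continuous_fderiv (by simp)).clm_apply continuous_const
    exact (continuous_integral_smul_clm hφ' (φ.hasCompactSupport.fderiv_apply ℝ _)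
      (.id ℝ ℂ)).comp continuous_fst
  · exact ((continuous_integral_smul_clm φ.continuous φ.hasCompactSupport
      ((EuclideanSpace.proj j : EuclideanSpace ℂ (Fin d) →L[ℂ] ℂ).restrictScalars ℝ)).comp
      continuous_snd).neg

theorem norm_mulOp {W : Λ → ℝ} (ψ : (mulOp W).domain) :
    ‖mulOp W ψ‖ = (eLpNorm (fun x => W x • (ψ : L2 Λ) x) 2 volume).toReal :=
  Lp.norm_toLp _ (memLp_of_mem_mulDomain ψ.2)

theorem mem_graph_mulOp_iff {W : Λ → ℝ} {u : L2 Λ × L2 Λ} :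
    u ∈ (mulOp W).graph ↔ ∀ᵐ x, u.2 x = (W x : ℂ) * u.1 x := by
  rw [LinearPMap.mem_graph_iff]
  constructor
  · rintro ⟨ψ, hψ, hWψ⟩
    rw [← hψ, ← hWψ]
    exact MemLp.coeFn_toLp (memLp_of_mem_mulDomain ψ.2)
  · intro h
    have hmem : MemLp (fun x => (W x : ℂ) * u.1 x) 2 volume := (Lp.memLp u.2).ae_eq h
    exact ⟨⟨u.1, hmem⟩, rfl, Lp.ext (hmem.coeFn_toLp.trans (EventuallyEq.symm h))⟩

theorem isClosed_mulOp (W : Λ → ℝ) : (mulOp W).IsClosed := by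
  have graph_eq : ((mulOp W).graph : Set (L2 Λ × L2 Λ)) =
      {u | ∀ᵐ x, (u.1 x, u.2 x) ∈ {z : ℂ × ℂ | z.2 = (W x : ℂ) * z.1}} :=
    Set.ext fun _ => mem_graph_mulOp_iff
  rw [LinearPMap.IsClosed, graph_eq]
  exact isClosed_setOf_ae_mem fun x => isClosed_eq continuous_snd (continuous_fst.const_mul _)

theorem Admissible.exists_norm_mulOp_le {W : Λ → ℝ} (hW : Admissible W) :
    ∃ C : ℝ, 0 ≤ C ∧ ∀ (ψ : H1 Λ) (g : L2Vec Λ), HasWeakGradient (ψ : L2 Λ) g →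
      ‖mulOp W ⟨ψ, hW.2 ψ.2⟩‖ ≤ C * (‖g‖ + ‖(ψ : L2 Λ)‖) := by
  have : CompleteSpace (weakGradientGraph Λ) := isClosed_weakGradientGraph.completeSpace_coe
  obtain ⟨C, hC, hbound⟩ := exists_norm_comp_le_of_isClosed (isClosed_mulOp W)
    ((ContinuousLinearMap.fst ℂ (L2 Λ) (L2Vec Λ)).comp (weakGradientGraph Λ).subtypeL)
    fun u => hW.2 ⟨u.1.2, u.2⟩
  refine ⟨C, hC, fun ψ g hg => (hbound ⟨(ψ, g), hg⟩).trans ?_⟩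
  have norm_pair_le : ‖((ψ : L2 Λ), g)‖ ≤ ‖g‖ + ‖(ψ : L2 Λ)‖ :=
    max_le (le_add_of_nonneg_left (norm_nonneg _)) (le_add_of_nonneg_right (norm_nonneg _))
  exact mul_le_mul_of_nonneg_left norm_pair_le hC

theorem mulDomain_sq_le {V : Λ → ℝ} (hV : Measurable V) :
    mulDomain (fun x => V x ^ 2) ≤ mulDomain V := fun ψ h =>
  memLp_smul_of_memLp_sq_smul (hV.aestronglyMeasurable.smul (Lp.aestronglyMeasurable ψ))
    (memLp_of_mem_mulDomain h) (Lp.memLp ψ)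

theorem Admissible.of_sq {V : Λ → ℝ} (hV : Measurable V) (hV2 : Admissible fun x => V x ^ 2) :
    Admissible V :=
  ⟨hV, hV2.2.trans (mulDomain_sq_le hV)⟩

theorem norm_mulOp_sq_le_mul {V : Λ → ℝ} {ψ : L2 Λ} (hV : ψ ∈ (mulOp V).domain)
    (hV2 : ψ ∈ (mulOp fun x => V x ^ 2).domain) :
    ‖mulOp V ⟨ψ, hV⟩‖ ^ 2 ≤ ‖mulOp (fun x => V x ^ 2) ⟨ψ, hV2⟩‖ * ‖ψ‖ := by
  have hV2ψ := memLp_of_mem_mulDomain hV2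
  rw [norm_mulOp, norm_mulOp, Lp.norm_def, ← ENNReal.toReal_pow, ← ENNReal.toReal_mul]
  exact ENNReal.toReal_mono (ENNReal.mul_ne_top hV2ψ.eLpNorm_ne_top (Lp.eLpNorm_ne_top ψ))
    (eLpNorm_smul_sq_le_mul hV2ψ.aestronglyMeasurable (Lp.aestronglyMeasurable ψ))

end AdmissiblePotential

open AdmissiblePotential in
theorem mainTheorem6_general {d : ℕ} {Λ : Opens (EuclideanSpace ℝ (Fin d))} (V : Λ → ℝ)
    (hV : Measurable V) (hV2 : Admissible fun x => V x ^ 2) :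
    ∃ hadm : Admissible V, ∃ a b : ℝ, 0 ≤ a ∧ 0 ≤ b ∧
      ∀ ε : ℝ, 0 < ε → IsFormBound hadm (a * ε) (a / ε + b) := by
  obtain ⟨C, hC, hbound⟩ := hV2.exists_norm_mulOp_le
  refine ⟨.of_sq hV hV2, C / 2, C, by positivity, hC, fun ε hε =>
    ⟨by positivity, by positivity, fun ψ g hg => ?_⟩⟩
  have young : 2 * ‖g‖ * ‖(ψ : L2 Λ)‖ ≤ ε * ‖g‖ ^ 2 + ε⁻¹ * ‖(ψ : L2 Λ)‖ ^ 2 :=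
    two_mul_le_add_mul_sq hε
  calc ‖mulOp V ⟨ψ, _⟩‖ ^ 2
      ≤ ‖mulOp (fun x => V x ^ 2) ⟨ψ, hV2.2 ψ.2⟩‖ * ‖(ψ : L2 Λ)‖ := norm_mulOp_sq_le_mul _ _
    _ ≤ C * (‖g‖ + ‖(ψ : L2 Λ)‖) * ‖(ψ : L2 Λ)‖ := by gcongr; exact hbound ψ g hg
    _ = C / 2 * (2 * ‖g‖ * ‖(ψ : L2 Λ)‖) + C * ‖(ψ : L2 Λ)‖ ^ 2 := by ring
    _ ≤ C / 2 * (ε * ‖g‖ ^ 2 + ε⁻¹ * ‖(ψ : L2 Λ)‖ ^ 2) + C * ‖(ψ : L2 Λ)‖ ^ 2 := by gcongr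
    _ = C / 2 * ε * ‖g‖ ^ 2 + (C / 2 / ε + C) * ‖(ψ : L2 Λ)‖ ^ 2 := by ring

theorem mainTheorem6 {d : ℕ} (l r : Fin d → EReal) (hlr : ∀ j, l j < r j)
    (V : AdmissiblePotential.genRect l r → ℝ) (hV : Measurable V)
    (hV2 : AdmissiblePotential.Admissible (fun x => V x ^ 2)) :
    ∃ hadm : AdmissiblePotential.Admissible V,
      ∃ a b : ℝ, 0 ≤ a ∧ 0 ≤ b ∧
        ∀ ε : ℝ, 0 < ε → AdmissiblePotential.IsFormBound hadm (a * ε) (a / ε + b) :=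
  mainTheorem6_general V hV hV2
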